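/- Let $\mathbb D=\{z\in\mathbb C:|z|<1\}$, let $H^\infty$ be the space of holomorphic functions $f$ on $\mathbb D$ with $\|f\|_\infty=\sup_{z\in\mathbb D}|f(z)|<\infty$, and for an integer $n\ge 0$ let $E_n(f)_\infty=\inf_P\|f-P\|_\infty$, where $P$ runs over the complex polynomials of degree at most $n-1$ (so $E_0(f)_\infty=\|f\|_\infty$). For $f,g$ holomorphic in $\mathbb D$ let $(f*g)(z)=\sum_{k\ge 0}\hat f_k\hat g_kz^k$ be the Hadamard product, where $\hat f_k=f^{(k)}(0)/k!$. A bounded linear operator $T:H^\infty\to H^\infty$ is called best approximation-preserving (BAP) of order $n$ over $H^\infty$ if $T(e_n)=e_n$, where $e_n(z)=z^n$, and $\|T(f)\|_\infty\le E_n(f)_\infty$ for all $f\in H^\infty$. Theorem. Let $n\ge 0$ be an integer, let $K_n$ and $L_n$ be holomorphic in $\mathbb D$, and let $L_n(z)=O(z^n)$ as $z\to 0$. Then the operator $T_n$, $T_n(f)=K_n*f$, is BAP of order $n$ over $H^\infty$ and satisfies $$\sup_{z\in\mathbb D}\bigl(|T_n(f)(z)|+|(L_n*f)(z)|\bigr)\le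 E_n(f)_\infty\quad\text{for all } f\in H^\infty$$ if and only if the following three conditions hold: 1. $K_n(z)=z^n+O(z^{2n+1})$ as $z\to 0$; 2. $L_n(z)=O(z^{2n+1})$ as $z\to 0$; 3. $\displaystyle\mathrm{Re}\,\frac{K_n(z)}{z^n}-\frac12\ge\left|\frac{L_n(z)}{z^n}\right|$ for all $z\in\mathbb D\setminus\{0\}$. (By 1 and 2 the quotients in 3 extend holomorphically to $z=0$ with values $1$ and $0$, so 3 then holds at $z=0$ as well.) -/

import Mathlib

open scoped ENNReal NNReal Topology

noncomputable section

namespace BAP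

/-- The open unit disc in `ℂ`. Functions on the disc are represented by functions `ℂ → ℂ`, of which
only the values on the disc matter. -/
abbrev disc : Set ℂ := Metric.ball (0 : ℂ) 1

/-- The norm of `H^∞`: the supremum of `|f z|` over the unit disc, possibly infinite. -/
def supNorm (f : ℂ → ℂ) : ℝ≥0∞ := ⨆ z ∈ disc, ‖f z‖ₑ

/-- Membership in the Hardy space `H^∞`: holomorphic in the disc with finite sup norm. -/
def MemHInf (f : ℂ → ℂ) : Prop := DifferentiableOn ℂ f disc ∧ supNorm f < ∞

/-- The best approximation `E_n(f)_∞` by polynomials of degree at most `n - 1`. For `n = 0` the only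
polynomial of degree `< 0` is the zero polynomial, so that `E_0(f)_∞` is the norm of `f`. -/
def bestApprox (n : ℕ) (f : ℂ → ℂ) : ℝ≥0∞ :=
  ⨅ (P : Polynomial ℂ) (_ : P.degree < (n : WithBot ℕ)), supNorm (fun z => f z - P.eval z)

/-- The Taylor coefficient `f^(k)(0) / k!`. -/
def taylorCoeff (f : ℂ → ℂ) (k : ℕ) : ℂ := iteratedDeriv k f 0 / (k.factorial : ℂ)

/-- The Hadamard product of two functions holomorphic in the disc (the series converges absolutely
at every point of the disc). -/
def hadamard (f g : ℂ → ℂ) : ℂ → ℂ := fun z => ∑' k : ℕ, taylorCoeff f k * taylorCoeff g k * z ^ k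

/-- `T` is a bounded linear operator from `H^∞` into `H^∞`; identities between functions are
identities on the disc. -/
structure IsBoundedLinearOnHInf (T : (ℂ → ℂ) → ℂ → ℂ) : Prop where
  mapsTo : ∀ f, MemHInf f → MemHInf (T f)
  map_add : ∀ f g, MemHInf f → MemHInf g → Set.EqOn (T (f + g)) (T f + T g) disc
  map_smul : ∀ (c : ℂ) (f), MemHInf f → Set.EqOn (T (c • f)) (c • T f) disc
  bounded : ∃ C : ℝ≥0, ∀ f, MemHInf f → supNorm (T f) ≤ C * supNorm f

/-- `T` is a best approximation-preserving operator of order `n` over `H^∞`. -/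
structure IsBAP (n : ℕ) (T : (ℂ → ℂ) → ℂ → ℂ) : Prop extends IsBoundedLinearOnHInf T where
  map_monomial : Set.EqOn (T (fun z => z ^ n)) (fun z => z ^ n) disc
  norm_le : ∀ f, MemHInf f → supNorm (T f) ≤ bestApprox n f

end BAP

end

namespace BAP

open MeasureTheory AddCircle

/-! Rotating `L` by scalars `σ` reduces the two-operator inequality to bounds on convolution with
the single function `F = K + σ • L`, since `|a| + |b|` is attained as `|a + σ b|` with `|σ| = 1`.

Sufficiency: on a circle of radius `s < 1`, `2 Re (F / z ^ n) - 1` is a nonnegative density. After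
rescaling `F` by its `n`-th coefficient there, the density has mass one and its Fourier coefficients
reproduce those of `F`; the gap between degrees `n` and `2n` removes the interference of the
conjugate part. Hence `F * f` is dominated by an average of values of `f` (`norm_hadamard_le`).
Coefficients below `n` vanish, so `f` may be replaced by `f - P`, which produces `E_n`.

Necessity: evaluating `F * Q` at `1` gives a functional of norm at most one on polynomials that
sends `z ^ n` to `1`. As for states, this forces positivity relative to `z ^ n`
(`neg_le_re_of_norm_le`). Two test polynomials then give the coefficient gap and the half-plane
condition (`coeff_eq_zero_of_norm_le`, `half_le_re_of_norm_le`). -/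

/-! ### Taylor coefficients -/

theorem analyticAt_zero {f : ℂ → ℂ} (hf : DifferentiableOn ℂ f disc) : AnalyticAt ℂ f 0 :=
  hf.analyticAt (Metric.ball_mem_nhds _ one_pos)

theorem taylorCoeff_add {f g : ℂ → ℂ} (hf : AnalyticAt ℂ f 0) (hg : AnalyticAt ℂ g 0) (k : ℕ) :
    taylorCoeff (f + g) k = taylorCoeff f k + taylorCoeff g k := by
  simp only [taylorCoeff]
  rw [iteratedDeriv_add hf.contDiffAt hg.contDiffAt, add_div]

theorem taylorCoeff_smul (c : ℂ) (f : ℂ → ℂ) (k : ℕ) :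
    taylorCoeff (c • f) k = c * taylorCoeff f k := by
  simp only [taylorCoeff]
  rw [iteratedDeriv_const_smul_field, smul_eq_mul, mul_div_assoc]

theorem taylorCoeff_sub {f g : ℂ → ℂ} (hf : AnalyticAt ℂ f 0) (hg : AnalyticAt ℂ g 0) (k : ℕ) :
    taylorCoeff (f - g) k = taylorCoeff f k - taylorCoeff g k := by
  have h : f - g = f + (-1 : ℂ) • g := by ext; simp [sub_eq_add_neg]
  rw [h, taylorCoeff_add hf (hg.const_smul), taylorCoeff_smul]
  ring

theorem taylorCoeff_pow (n k : ℕ) :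
    taylorCoeff (fun z => z ^ n) k = if k = n then 1 else 0 := by
  simp only [taylorCoeff, iteratedDeriv_fun_pow_zero]
  rcases eq_or_ne k n with rfl | h
  · simp [k.factorial_ne_zero]
  · simp [h]

theorem analyticAt_polynomial (P : Polynomial ℂ) (z : ℂ) : AnalyticAt ℂ (fun z => P.eval z) z :=
  P.differentiable.analyticAt z

theorem taylorCoeff_polynomial (P : Polynomial ℂ) (k : ℕ) :
    taylorCoeff (fun z => P.eval z) k = P.coeff k := by
  induction P using Polynomial.induction_on' with
  | add p q hp hq =>
    have h : (fun z => (p + q).eval z) = (fun z => p.eval z) + fun z => q.eval z := by ext; simp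
    rw [h, taylorCoeff_add (analyticAt_polynomial p 0) (analyticAt_polynomial q 0), hp, hq,
      Polynomial.coeff_add]
  | monomial m a =>
    have h : (fun z => (Polynomial.monomial m a).eval z) = a • fun z : ℂ => z ^ m := by ext; simp
    rw [h, taylorCoeff_smul, taylorCoeff_pow, Polynomial.coeff_monomial]
    simp [eq_comm]

theorem hasSum_taylorCoeff {f : ℂ → ℂ} (hf : DifferentiableOn ℂ f disc) {z : ℂ} (hz : z ∈ disc) :
    HasSum (fun k => taylorCoeff f k * z ^ k) (f z) := by
  refine (Complex.hasSum_taylorSeries_on_ball hf hz).congr_fun fun k => ?_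
  simp only [taylorCoeff, sub_zero, smul_eq_mul]
  ring

theorem summable_norm_taylorCoeff {f : ℂ → ℂ} (hf : DifferentiableOn ℂ f disc) {r : ℝ}
    (h0 : 0 ≤ r) (h1 : r < 1) : Summable fun k => ‖taylorCoeff f k‖ * r ^ k := by
  have hr : (r : ℂ) ∈ disc := by simpa [abs_of_nonneg h0] using h1
  simpa [abs_of_nonneg h0] using (hasSum_taylorCoeff hf hr).summable.norm

theorem isBigO_pow_iff {f : ℂ → ℂ} (hf : AnalyticAt ℂ f 0) (m : ℕ) :
    f =O[𝓝 0] (fun z : ℂ => z ^ m) ↔ ∀ k < m, taylorCoeff f k = 0 := by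
  have key : (∀ k < m, taylorCoeff f k = 0) ↔ (m : ℕ∞) ≤ analyticOrderAt f 0 := by
    rw [natCast_le_analyticOrderAt_iff_iteratedDeriv_eq_zero hf]
    refine forall₂_congr fun k _ => ?_
    simp [taylorCoeff, k.factorial_ne_zero]
  rw [key]
  constructor
  · intro hO
    by_contra! hlt
    obtain ⟨k, hk⟩ := ENat.ne_top_iff_exists.mp (ne_top_of_lt hlt)
    rw [← hk, Nat.cast_lt] at hlt
    obtain ⟨g, hg, hg0, hfg⟩ := (hf.analyticOrderAt_eq_natCast).mp hk.symm
    refine hg0 ?_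
    -- Cancelling `z ^ k` leaves a positive power of `z`, which forces `g 0 = 0`.
    have hO' : g =O[𝓝[≠] 0] fun z : ℂ => z ^ (m - k) := by
      obtain ⟨C, hC⟩ := hO.bound
      refine Asymptotics.IsBigO.of_bound C ?_
      filter_upwards [hC.filter_mono nhdsWithin_le_nhds, hfg.filter_mono nhdsWithin_le_nhds,
        self_mem_nhdsWithin] with z h1 h2 h3
      have h3' : 0 < ‖z‖ ^ k := pow_pos (norm_pos_iff.mpr h3) k
      rw [h2, sub_zero, norm_smul, norm_pow, norm_pow, ← Nat.add_sub_cancel' hlt.le, pow_add,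
        mul_left_comm] at h1
      rw [norm_pow]
      exact le_of_mul_le_mul_left h1 h3'
    have ht : Filter.Tendsto g (𝓝[≠] 0) (𝓝 0) := by
      refine hO'.trans_tendsto ?_
      have : Filter.Tendsto (fun z : ℂ => z ^ (m - k)) (𝓝 0) (𝓝 (0 ^ (m - k))) :=
        (continuous_pow _).tendsto 0
      rw [zero_pow (by omega)] at this
      exact this.mono_left nhdsWithin_le_nhds
    exact tendsto_nhds_unique (hg.continuousAt.tendsto.mono_left nhdsWithin_le_nhds) ht
  · intro h
    obtain ⟨g, hg, hfg⟩ := (natCast_le_analyticOrderAt hf).mp h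
    have h1 : (fun z : ℂ => z ^ m * g z) =O[𝓝 0] fun z : ℂ => z ^ m * 1 :=
      (Asymptotics.isBigO_refl _ _).mul (hg.continuousAt.tendsto.isBigO_one ℂ)
    simp only [mul_one] at h1
    refine Filter.EventuallyEq.trans_isBigO ?_ h1
    filter_upwards [hfg] with z hz
    simpa using hz

/-! ### Hadamard products -/

theorem summable_norm_hadamard {f g : ℂ → ℂ} (hf : DifferentiableOn ℂ f disc)
    (hg : DifferentiableOn ℂ g disc) {r : ℝ} (h0 : 0 ≤ r) (h1 : r < 1) :
    Summable fun k => ‖taylorCoeff f k‖ * ‖taylorCoeff g k‖ * r ^ k := by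
  -- Splitting `r ^ k` as `√r ^ k * √r ^ k` makes the series the diagonal of a product of two
  -- convergent ones.
  have hs0 := Real.sqrt_nonneg r
  have hs1 : √r < 1 := by rw [Real.sqrt_lt' one_pos]; simpa using h1
  have hF := summable_norm_taylorCoeff hf hs0 hs1
  have hG := summable_norm_taylorCoeff hg hs0 hs1
  refine (hF.mul_of_nonneg hG (fun _ => by positivity) (fun _ => by positivity)
    |>.comp_injective (i := fun k : ℕ => (k, k)) fun a b h => (Prod.mk.inj h).1).congr fun k => ?_
  simp only [Function.comp]
  rw [mul_mul_mul_comm, ← mul_pow, Real.mul_self_sqrt h0]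

theorem summable_hadamard {f g : ℂ → ℂ} (hf : DifferentiableOn ℂ f disc)
    (hg : DifferentiableOn ℂ g disc) {z : ℂ} (hz : z ∈ disc) :
    Summable fun k => taylorCoeff f k * taylorCoeff g k * z ^ k := by
  refine Summable.of_norm ?_
  simpa using summable_norm_hadamard hf hg (norm_nonneg z) (by simpa using hz)

theorem differentiableOn_hadamard {f g : ℂ → ℂ} (hf : DifferentiableOn ℂ f disc)
    (hg : DifferentiableOn ℂ g disc) : DifferentiableOn ℂ (hadamard f g) disc := by
  intro z hz
  obtain ⟨r, hzr, hr1⟩ := exists_between (show ‖z‖ < 1 by simpa using hz)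
  have h0 : 0 ≤ r := (norm_nonneg z).trans hzr.le
  have h : DifferentiableOn ℂ (hadamard f g) (Metric.ball 0 r) := by
    refine Complex.differentiableOn_tsum_of_summable_norm (summable_norm_hadamard hf hg h0 hr1)
      (fun k => by fun_prop) Metric.isOpen_ball fun k w hw => ?_
    have hw' : ‖w‖ ≤ r := by simpa using (Metric.mem_ball.mp hw).le
    simp only [norm_mul, norm_pow]
    gcongr
  exact (h.differentiableAt (Metric.isOpen_ball.mem_nhds (by simpa using hzr))).differentiableWithinAt

theorem hadamard_add_right {f g₁ g₂ : ℂ → ℂ} (hf : DifferentiableOn ℂ f disc)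
    (hg₁ : DifferentiableOn ℂ g₁ disc) (hg₂ : DifferentiableOn ℂ g₂ disc) {z : ℂ} (hz : z ∈ disc) :
    hadamard f (g₁ + g₂) z = hadamard f g₁ z + hadamard f g₂ z := by
  simp only [hadamard]
  rw [← (summable_hadamard hf hg₁ hz).tsum_add (summable_hadamard hf hg₂ hz)]
  refine tsum_congr fun k => ?_
  rw [taylorCoeff_add (analyticAt_zero hg₁) (analyticAt_zero hg₂)]
  ring

theorem hadamard_add_left {f₁ f₂ g : ℂ → ℂ} (hf₁ : DifferentiableOn ℂ f₁ disc)
    (hf₂ : DifferentiableOn ℂ f₂ disc) (hg : DifferentiableOn ℂ g disc) {z : ℂ} (hz : z ∈ disc) :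
    hadamard (f₁ + f₂) g z = hadamard f₁ g z + hadamard f₂ g z := by
  simp only [hadamard]
  rw [← (summable_hadamard hf₁ hg hz).tsum_add (summable_hadamard hf₂ hg hz)]
  refine tsum_congr fun k => ?_
  rw [taylorCoeff_add (analyticAt_zero hf₁) (analyticAt_zero hf₂)]
  ring

theorem hadamard_smul_right (c : ℂ) (f g : ℂ → ℂ) (z : ℂ) :
    hadamard f (c • g) z = c * hadamard f g z := by
  simp only [hadamard, taylorCoeff_smul, ← tsum_mul_left]
  exact tsum_congr fun k => by ring

theorem hadamard_smul_left (c : ℂ) (f g : ℂ → ℂ) (z : ℂ) :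
    hadamard (c • f) g z = c * hadamard f g z := by
  simp only [hadamard, taylorCoeff_smul, ← tsum_mul_left]
  exact tsum_congr fun k => by ring

theorem hadamard_polynomial (f : ℂ → ℂ) (P : Polynomial ℂ) (z : ℂ) :
    hadamard f (fun z => P.eval z) z = P.sum fun k a => taylorCoeff f k * a * z ^ k := by
  simp only [hadamard, taylorCoeff_polynomial, Polynomial.sum_def]
  refine tsum_eq_sum fun k hk => ?_
  simp [Polynomial.notMem_support_iff.mp hk]

theorem hadamard_pow (f : ℂ → ℂ) (n : ℕ) (z : ℂ) :
    hadamard f (fun z => z ^ n) z = taylorCoeff f n * z ^ n := by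
  simp only [hadamard, taylorCoeff_pow]
  rw [tsum_eq_single n fun k hk => by simp [hk]]
  simp

/-! ### Sup norm and best approximation -/

theorem enorm_le_supNorm (f : ℂ → ℂ) {z : ℂ} (hz : z ∈ disc) : ‖f z‖ₑ ≤ supNorm f :=
  le_iSup₂ (f := fun z (_ : z ∈ disc) => ‖f z‖ₑ) z hz

theorem MemHInf.norm_le {f : ℂ → ℂ} (hf : MemHInf f) {z : ℂ} (hz : z ∈ disc) :
    ‖f z‖ ≤ (supNorm f).toReal := by
  rw [← toReal_enorm]
  exact ENNReal.toReal_mono hf.2.ne (enorm_le_supNorm f hz)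

theorem supNorm_le_of_norm_le {f : ℂ → ℂ} {M : ℝ} (h : ∀ z ∈ disc, ‖f z‖ ≤ M) :
    supNorm f ≤ ENNReal.ofReal M :=
  iSup₂_le fun z hz => by
    rw [← ofReal_norm]
    exact ENNReal.ofReal_le_ofReal (h z hz)

theorem bestApprox_le_supNorm_sub (n : ℕ) (f : ℂ → ℂ) (P : Polynomial ℂ)
    (hP : P.degree < (n : WithBot ℕ)) : bestApprox n f ≤ supNorm fun z => f z - P.eval z :=
  iInf₂_le P hP

theorem bestApprox_le_supNorm (n : ℕ) (f : ℂ → ℂ) : bestApprox n f ≤ supNorm f := by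
  simpa using bestApprox_le_supNorm_sub n f 0 (by simp [bot_lt_iff_ne_bot])

theorem norm_polynomial_le_of_circle (P : Polynomial ℂ) {M : ℝ}
    (h : ∀ z : ℂ, ‖z‖ = 1 → ‖P.eval z‖ ≤ M) {z : ℂ} (hz : z ∈ disc) : ‖P.eval z‖ ≤ M := by
  refine Complex.norm_le_of_forall_mem_frontier_norm_le (U := disc) Metric.isBounded_ball
    (Differentiable.diffContOnCl P.differentiable) (fun w hw => h w ?_) (subset_closure hz)
  rw [frontier_ball _ one_ne_zero] at hw
  simpa using hw

theorem memHInf_polynomial (P : Polynomial ℂ) : MemHInf fun z => P.eval z := by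
  refine ⟨P.differentiable.differentiableOn, ?_⟩
  obtain ⟨M, hM⟩ := (isCompact_sphere (0 : ℂ) 1).exists_bound_of_continuousOn
    P.continuous.continuousOn
  exact (supNorm_le_of_norm_le fun z hz =>
    norm_polynomial_le_of_circle P (fun w hw => hM w (by simpa using hw)) hz).trans_lt
    ENNReal.ofReal_lt_top

/-! ### Sufficiency: the positive kernel on the circle -/

theorem integral_fourier_haar (k : ℤ) :
    ∫ x : UnitAddCircle, fourier k x ∂haarAddCircle = if k = 0 then 1 else 0 := by
  have h := congrFun (fourierCoeff_fourier (T := 1) k) 0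
  simpa [fourierCoeff, Pi.single_apply, eq_comm] using h

theorem norm_fourier_apply (k : ℤ) (x : UnitAddCircle) : ‖(fourier k x : ℂ)‖ = 1 := by
  rw [fourier_apply]
  exact Circle.norm_coe _

theorem continuous_tsum_mul_fourier {c : ℕ → ℂ} (hc : Summable fun k => ‖c k‖) :
    Continuous fun x : UnitAddCircle => ∑' k, c k * fourier (k : ℤ) x := by
  refine continuous_tsum (fun k => by fun_prop) hc fun k x => ?_
  rw [norm_mul, norm_fourier_apply, mul_one]

theorem hasSum_integral_mul {a : ℕ → ℂ} (ha : Summable fun k => ‖a k‖)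
    (φ : ℕ → UnitAddCircle → ℂ) (hφ : ∀ k, Continuous (φ k)) {B : ℝ} (hB : ∀ k x, ‖φ k x‖ ≤ B) :
    HasSum (fun k => a k * ∫ x, φ k x ∂haarAddCircle)
      (∫ x, ∑' k, a k * φ k x ∂haarAddCircle) := by
  have hint : ∀ k, Integrable (fun x => a k * φ k x) (haarAddCircle (T := 1)) := fun k =>
    (((hφ k).const_smul (a k)).integrable_of_hasCompactSupport
      (HasCompactSupport.of_compactSpace _))
  have h := hasSum_integral_of_summable_integral_norm hint ?_
  · simpa only [integral_const_mul] using h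
  · refine Summable.of_nonneg_of_le (fun k => integral_nonneg fun x => norm_nonneg _)
      (fun k => ?_) (ha.mul_right B)
    calc ∫ x, ‖a k * φ k x‖ ∂(haarAddCircle (T := 1))
        ≤ ∫ x, ‖a k‖ * B ∂(haarAddCircle (T := 1)) := by
          refine integral_mono (hint k).norm (integrable_const _) fun x => ?_
          simp only [norm_mul]
          gcongr
          exact hB k x
      _ = ‖a k‖ * B := by simp

theorem integral_fourier_mul_tsum {c : ℕ → ℂ} (hc : Summable fun k => ‖c k‖) (p : ℤ) :
    ∫ x : UnitAddCircle, fourier p x * ∑' k, c k * fourier (k : ℤ) x ∂haarAddCircle =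
      if p ≤ 0 then c (-p).toNat else 0 := by
  have h := hasSum_integral_mul hc (fun k x => fourier (k + p : ℤ) x) (fun k => by fun_prop)
    (B := 1) (fun k x => (norm_fourier_apply _ x).le)
  have h1 : ∀ x : UnitAddCircle, fourier p x * ∑' k, c k * fourier (k : ℤ) x =
      ∑' k, c k * fourier (k + p : ℤ) x := fun x => by
    rw [← tsum_mul_left]
    exact tsum_congr fun k => by rw [fourier_add]; ring
  simp_rw [h1]
  rw [← h.tsum_eq]
  simp_rw [integral_fourier_haar]
  split_ifs with hp
  · rw [tsum_eq_single (-p).toNat fun k hk => by rw [if_neg (by omega), mul_zero]]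
    rw [if_pos (by omega), mul_one]
  · refine (tsum_congr fun k => ?_).trans tsum_zero
    rw [if_neg (by omega), mul_zero]

/-- The sum is the integral of a reflected copy of the series of `a`, times a character, against a
probability density; hence it inherits the bound `M`. -/
theorem norm_tsum_mul_le_of_half_le_re {a c : ℕ → ℂ} {n : ℕ} {M : ℝ}
    (ha : Summable fun k => ‖a k‖) (hc : Summable fun k => ‖c k‖)
    (hcoef : ∀ k ≤ 2 * n, c k = if k = n then 1 else 0)
    (hre : ∀ x : UnitAddCircle,
      1 / 2 ≤ (fourier (-n : ℤ) x * ∑' k, c k * fourier (k : ℤ) x).re)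
    (hM : ∀ x : UnitAddCircle, ‖∑' k, a k * fourier (k : ℤ) x‖ ≤ M) :
    ‖∑' k, a k * c k‖ ≤ M := by
  have hHc := continuous_tsum_mul_fourier hc
  have hI := integral_fourier_mul_tsum hc
  set H : UnitAddCircle → ℂ := fun x => ∑' k, c k * fourier (k : ℤ) x with hH
  have hint : ∀ g : UnitAddCircle → ℂ, Continuous g → Integrable g (haarAddCircle (T := 1)) :=
    fun g hg => hg.integrable_of_hasCompactSupport (HasCompactSupport.of_compactSpace _)
  set G : UnitAddCircle → ℂ := fun x =>
    ((2 * (fourier (-n : ℤ) x * H x).re - 1 : ℝ) : ℂ) with hG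
  have hGc : Continuous G := by fun_prop
  have hG0 : ∀ x, 0 ≤ 2 * (fourier (-n : ℤ) x * H x).re - 1 := fun x => by
    have := hre x
    linarith
  -- The three terms of `G` contribute `c m`, the conjugate of `c (2n - m)` (absent if `m > 2n`),
  -- and minus the Kronecker delta of `m` and `n`; by `hcoef` the last two cancel.
  have hψ : ∀ m : ℕ, ∫ x, fourier (n - m : ℤ) x * G x ∂haarAddCircle = c m := fun m => by
    have h1 : ∀ x, fourier (n - m : ℤ) x * G x = fourier (-m : ℤ) x * H x +
        (starRingEnd ℂ) (fourier (m - 2 * n : ℤ) x * H x) - fourier (n - m : ℤ) x := fun x => by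
      have e1 : G x = fourier (-n : ℤ) x * H x + (starRingEnd ℂ) (fourier (-n : ℤ) x * H x) - 1 := by
        rw [Complex.add_conj]
        simp [hG]
      rw [e1, map_mul, map_mul, ← fourier_neg, ← fourier_neg, mul_sub, mul_add, ← mul_assoc,
        ← mul_assoc, ← fourier_add, ← fourier_add, mul_one]
      congr 4 <;> congr 1 <;> ring_nf
    simp_rw [h1]
    rw [integral_sub (hint _ (by fun_prop)) (hint _ (by fun_prop)),
      integral_add (hint _ (by fun_prop)) (hint _ (by fun_prop)), integral_conj, hI, hI,
      integral_fourier_haar]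
    by_cases hm : m ≤ 2 * n
    · rw [if_pos (by omega), if_pos (by omega), hcoef (-(m - 2 * n : ℤ)).toNat (by omega)]
      have : (-(-m : ℤ)).toNat = m := by omega
      rw [this]
      by_cases hmn : m = n
      · rw [if_pos (by omega), if_pos (by omega)]; simp
      · rw [if_neg (by omega), if_neg (by omega)]; simp
    · rw [if_pos (by omega), if_neg (by omega), if_neg (by omega)]
      simp
  obtain ⟨B, hB⟩ : ∃ B, ∀ x, ‖G x‖ ≤ B := by
    obtain ⟨B, hB⟩ := isCompact_univ.exists_bound_of_continuousOn hGc.continuousOn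
    exact ⟨B, fun x => hB x trivial⟩
  have hsum := hasSum_integral_mul ha (fun m x => fourier (n - m : ℤ) x * G x)
    (fun m => by fun_prop) (B := B) (fun m x => by
      rw [norm_mul, norm_fourier_apply, one_mul]; exact hB x)
  simp_rw [hψ] at hsum
  rw [hsum.tsum_eq]
  have hpt : ∀ x, ‖∑' k, a k * (fourier (n - k : ℤ) x * G x)‖ ≤
      M * (2 * (fourier (-n : ℤ) x * H x).re - 1) := fun x => by
    have h1 : ∑' k, a k * (fourier (n - k : ℤ) x * G x) =
        (∑' k, a k * fourier (k : ℤ) (-x)) * (fourier (n : ℤ) x * G x) := by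
      rw [← tsum_mul_right]
      refine tsum_congr fun k => ?_
      have : fourier (k : ℤ) (-x) = fourier (-k : ℤ) x := by simp [fourier_apply]
      rw [this, sub_eq_neg_add, fourier_add]
      ring
    have h2 : ‖G x‖ = 2 * (fourier (-n : ℤ) x * H x).re - 1 := by
      rw [hG, Complex.norm_real, Real.norm_of_nonneg (hG0 x)]
    have h3 : ‖(fourier (n : ℤ) x : ℂ)‖ = 1 := norm_fourier_apply _ x
    rw [h1, norm_mul, norm_mul, h2, h3, one_mul]
    exact mul_le_mul_of_nonneg_right (hM _) (hG0 x)
  have hmass : ∫ x, (2 * (fourier (-n : ℤ) x * H x).re - 1) ∂haarAddCircle = 1 := by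
    have h := hψ n
    rw [hcoef n (by omega), if_pos rfl] at h
    simp only [sub_self, fourier_zero, one_mul] at h
    rw [hG, integral_complex_ofReal] at h
    exact_mod_cast h
  calc _ ≤ ∫ x, M * (2 * (fourier (-n : ℤ) x * H x).re - 1) ∂haarAddCircle :=
        norm_integral_le_of_norm_le
          ((show Continuous _ by fun_prop).integrable_of_hasCompactSupport
            (HasCompactSupport.of_compactSpace _)) (Filter.Eventually.of_forall hpt)
    _ = M := by rw [integral_const_mul, hmass, mul_one]

theorem fourier_natCast_apply (k : ℕ) (x : UnitAddCircle) :
    (fourier (k : ℤ) x : ℂ) = (fourier 1 x : ℂ) ^ k := by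
  induction k with
  | zero => simp
  | succ k ih => rw [Nat.cast_succ, fourier_add, ih, pow_succ]

theorem norm_hadamard_le {F f : ℂ → ℂ} {n : ℕ} {M : ℝ} (hF : DifferentiableOn ℂ F disc)
    (hcoef : ∀ k ≤ 2 * n, taylorCoeff F k = if k = n then 1 else 0)
    (hre : ∀ z ∈ disc, z ≠ 0 → 1 / 2 ≤ (F z / z ^ n).re) (hf : DifferentiableOn ℂ f disc)
    (hM : ∀ z ∈ disc, ‖f z‖ ≤ M) {z : ℂ} (hz : z ∈ disc) : ‖hadamard F f z‖ ≤ M := by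
  obtain ⟨s, hzs, hs1⟩ := exists_between (show ‖z‖ < 1 by simpa using hz)
  have hs0 : 0 < s := (norm_nonneg z).trans_lt hzs
  have hsC : (s : ℂ) ≠ 0 := by exact_mod_cast hs0.ne'
  have hM0 : 0 ≤ M := (norm_nonneg _).trans (hM z hz)
  have hq : ‖z / s‖ < 1 := by
    rw [norm_div, Complex.norm_real, Real.norm_of_nonneg hs0.le, div_lt_one hs0]
    exact hzs
  have hcirc : ∀ (w : ℂ) (x : UnitAddCircle), ‖w‖ < 1 → w * fourier 1 x ∈ disc := fun w x hw => by
    rw [mem_ball_zero_iff, norm_mul, norm_fourier_apply, mul_one]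
    exact hw
  have hsn : ‖(s : ℂ)‖ < 1 := by rwa [Complex.norm_real, Real.norm_of_nonneg hs0.le]
  -- Write `z = (z / s) * s`, so that both series converge absolutely on the circle; dividing by `s
  -- ^ n` normalizes `c n` to `1`.
  have main := norm_tsum_mul_le_of_half_le_re (n := n) (M := M)
    (a := fun k => taylorCoeff f k * (z / s) ^ k) (c := fun k => taylorCoeff F k * s ^ k / s ^ n)
    ?_ ?_ ?_ ?_ ?_
  · have h1 : ∑' k, taylorCoeff f k * (z / s) ^ k * (taylorCoeff F k * s ^ k / s ^ n) =
        hadamard F f z / s ^ n := by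
      rw [hadamard, ← tsum_div_const]
      refine tsum_congr fun k => ?_
      rw [div_pow]
      field_simp
    rw [h1, norm_div, norm_pow, Complex.norm_real, Real.norm_of_nonneg hs0.le,
      div_le_iff₀ (by positivity)] at main
    exact main.trans (mul_le_of_le_one_right hM0 (pow_le_one₀ hs0.le hs1.le))
  · simpa using summable_norm_taylorCoeff hf (norm_nonneg (z / s)) hq
  · have := (summable_norm_taylorCoeff hF hs0.le hs1).div_const (s ^ n)
    simpa [abs_of_pos hs0] using this
  · intro k hk
    rw [hcoef k hk]
    split_ifs with h
    · rw [h]; field_simp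
    · simp
  · intro x
    have hx0 : (fourier 1 x : ℂ) ≠ 0 := norm_ne_zero_iff.mp (by
      rw [norm_fourier_apply]; exact one_ne_zero)
    have hmem := hcirc s x hsn
    have h := hre _ hmem (mul_ne_zero hsC hx0)
    have hneg : (fourier (-n : ℤ) x : ℂ) = ((fourier 1 x : ℂ) ^ n)⁻¹ := by
      rw [← mul_eq_one_iff_eq_inv₀ (pow_ne_zero _ hx0), ← fourier_natCast_apply, ← fourier_add]
      simp
    have hsum : ∑' k, taylorCoeff F k * s ^ k / s ^ n * fourier (k : ℤ) x =
        F (s * fourier 1 x) / s ^ n := by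
      rw [← (hasSum_taylorCoeff hF hmem).tsum_eq, ← tsum_div_const]
      refine tsum_congr fun k => ?_
      rw [fourier_natCast_apply, mul_pow]
      ring
    rw [hneg, hsum]
    convert h using 2
    rw [mul_pow]
    field_simp
  · intro x
    have hmem := hcirc (z / s) x hq
    have hsum : ∑' k, taylorCoeff f k * (z / s) ^ k * fourier (k : ℤ) x =
        f (z / s * fourier 1 x) := by
      rw [← (hasSum_taylorCoeff hf hmem).tsum_eq]
      refine tsum_congr fun k => ?_
      rw [fourier_natCast_apply, mul_pow]
      ring
    rw [hsum]
    exact hM _ hmem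

/-! ### Necessity: positivity of the coefficient functional -/

/-- The linear functional on polynomials with value `c k` at `X ^ k`. -/
noncomputable def coeffFunctional (c : ℕ → ℂ) : Polynomial ℂ →ₗ[ℂ] ℂ :=
  Polynomial.lsum fun k => c k • LinearMap.id

theorem coeffFunctional_C_mul_X_pow (c : ℕ → ℂ) (a : ℂ) (k : ℕ) :
    coeffFunctional c (Polynomial.C a * Polynomial.X ^ k) = c k * a := by
  rw [Polynomial.C_mul_X_pow_eq_monomial]
  simp [coeffFunctional, Polynomial.lsum_apply, Polynomial.sum_monomial_index]

theorem coeffFunctional_X_pow (c : ℕ → ℂ) (k : ℕ) :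
    coeffFunctional c (Polynomial.X ^ k) = c k := by
  simpa using coeffFunctional_C_mul_X_pow c 1 k

/-- The functional is the value of `F * Q` at the boundary point `1`, reached by continuity because
`F * Q` is a polynomial. -/
theorem norm_coeffFunctional_le {F : ℂ → ℂ}
    (hF : ∀ Q : Polynomial ℂ, ∀ M : ℝ, (∀ z : ℂ, ‖z‖ = 1 → ‖Q.eval z‖ ≤ M) →
      ∀ z ∈ disc, ‖hadamard F (fun z => Q.eval z) z‖ ≤ M)
    (Q : Polynomial ℂ) (M : ℝ) (hQ : ∀ z : ℂ, ‖z‖ = 1 → ‖Q.eval z‖ ≤ M) :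
    ‖coeffFunctional (taylorCoeff F) Q‖ ≤ M := by
  have hcont : Continuous fun z : ℂ => ‖Q.sum fun k a => taylorCoeff F k * a * z ^ k‖ := by
    simp only [Polynomial.sum_def]
    fun_prop
  have hcl : closure disc ⊆ {z : ℂ | ‖Q.sum fun k a => taylorCoeff F k * a * z ^ k‖ ≤ M} :=
    closure_minimal (fun z hz => by
      have := hF Q M hQ z hz
      rwa [hadamard_polynomial] at this) (isClosed_le hcont continuous_const)
  have h1 : (1 : ℂ) ∈ closure disc := by
    rw [closure_ball _ one_ne_zero]
    simp
  have := hcl h1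
  simpa [coeffFunctional, Polynomial.lsum_apply] using this

/-- A contractive functional that is `1` at `z ^ n` is positive relative to `z ^ n`: perturbing `z ^
n` to `z ^ n - ε R`, with `R` in the positive cone, raises the norm only to second order in `ε`. -/
theorem neg_le_re_of_norm_le {Λ : Polynomial ℂ →ₗ[ℂ] ℂ} {n : ℕ}
    (hΛ : ∀ Q : Polynomial ℂ, ∀ M : ℝ, (∀ z : ℂ, ‖z‖ = 1 → ‖Q.eval z‖ ≤ M) → ‖Λ Q‖ ≤ M)
    (hn : Λ (Polynomial.X ^ n) = 1) (Q : Polynomial ℂ) (δ : ℝ)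
    (hQ : ∀ z : ℂ, ‖z‖ = 1 → -δ ≤ (Q.eval z * (starRingEnd ℂ) (z ^ n)).re) :
    -δ ≤ (Λ Q).re := by
  set R : Polynomial ℂ := Q + (δ : ℂ) • Polynomial.X ^ n with hR
  have hnn : ∀ z : ℂ, ‖z‖ = 1 → z ^ n * (starRingEnd ℂ) (z ^ n) = 1 := fun z hz => by
    rw [Complex.mul_conj, Complex.normSq_eq_norm_sq, norm_pow, hz]
    simp
  have hR0 : ∀ z : ℂ, ‖z‖ = 1 → 0 ≤ (R.eval z * (starRingEnd ℂ) (z ^ n)).re := fun z hz => by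
    have h : R.eval z * (starRingEnd ℂ) (z ^ n) = Q.eval z * (starRingEnd ℂ) (z ^ n) + δ := by
      rw [hR, Polynomial.eval_add, Polynomial.eval_smul, Polynomial.eval_pow, Polynomial.eval_X,
        add_mul, smul_eq_mul, mul_assoc, hnn z hz, mul_one]
    rw [h, Complex.add_re, Complex.ofReal_re]
    linarith [hQ z hz]
  have hΛR : (Λ R).re = (Λ Q).re + δ := by
    rw [hR, map_add, map_smul, hn]
    simp
  obtain ⟨B, hB⟩ := (isCompact_sphere (0 : ℂ) 1).exists_bound_of_continuousOn
    R.continuous.continuousOn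
  have key : ∀ ε : ℝ, 0 < ε → -(2 * (Λ R).re) ≤ ε * B ^ 2 := fun ε hε => by
    have hb : ∀ z : ℂ, ‖z‖ = 1 →
        ‖(Polynomial.X ^ n - (ε : ℂ) • R : Polynomial ℂ).eval z‖ ≤ √(1 + ε ^ 2 * B ^ 2) := by
      intro z hz
      refine Real.le_sqrt_of_sq_le ?_
      have hBz := hB z (by simpa using hz)
      have hz1 : ‖z ^ n‖ = 1 := by rw [norm_pow, hz, one_pow]
      have h0 := hR0 z hz
      rw [Polynomial.eval_sub, Polynomial.eval_smul, Polynomial.eval_pow, Polynomial.eval_X,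
        smul_eq_mul, ← Complex.normSq_eq_norm_sq, Complex.normSq_sub, Complex.normSq_eq_norm_sq,
        Complex.normSq_eq_norm_sq, hz1, norm_mul, Complex.norm_real, Real.norm_of_nonneg hε.le]
      have hre : (z ^ n * (starRingEnd ℂ) (ε * R.eval z)).re =
          ε * (R.eval z * (starRingEnd ℂ) (z ^ n)).re := by
        simp only [map_mul, Complex.conj_ofReal, Complex.mul_re, Complex.mul_im, Complex.conj_re,
          Complex.conj_im, Complex.ofReal_re, Complex.ofReal_im]
        ring
      rw [hre]
      have h1 : ‖R.eval z‖ ^ 2 ≤ B ^ 2 := by gcongr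
      nlinarith [mul_nonneg hε.le h0, mul_le_mul_of_nonneg_left h1 (sq_nonneg ε)]
    have h := hΛ _ _ hb
    rw [map_sub, map_smul, hn, smul_eq_mul] at h
    have h2 : ‖1 - (ε : ℂ) * Λ R‖ ^ 2 ≤ 1 + ε ^ 2 * B ^ 2 := by
      rw [← Real.sq_sqrt (show (0 : ℝ) ≤ 1 + ε ^ 2 * B ^ 2 by positivity)]
      gcongr
    have h3 : (1 - ε * (Λ R).re) ^ 2 ≤ ‖1 - (ε : ℂ) * Λ R‖ ^ 2 := by
      rw [← sq_abs]
      have := Complex.abs_re_le_norm (1 - (ε : ℂ) * Λ R)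
      simp only [Complex.sub_re, Complex.one_re, Complex.re_ofReal_mul] at this
      gcongr
    have h4 : ε * -(2 * (Λ R).re) ≤ ε * (ε * B ^ 2) := by nlinarith [sq_nonneg (ε * (Λ R).re)]
    exact le_of_mul_le_mul_left h4 hε
  have hfin : 0 ≤ (Λ R).re := by
    by_contra! hneg
    -- This `ε` makes the right side of `key` less than `-(Λ R).re`, in place of a limit `ε → 0`.
    have h := key (-(Λ R).re / (B ^ 2 + 1)) (by apply div_pos <;> nlinarith)
    rw [div_mul_eq_mul_div, le_div_iff₀ (by positivity)] at h
    nlinarith [sq_nonneg B]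
  linarith

/-- The test polynomial times the conjugate of `z ^ n` is purely imaginary on the circle, while its
`z ^ (n - j)` term is annihilated. The choice of `a` makes the functional `-|c (n + j)| ^ 2`, which
positivity then forces to be zero. -/
theorem coeff_eq_zero_of_norm_le {c : ℕ → ℂ} {n : ℕ}
    (hc : ∀ Q : Polynomial ℂ, ∀ M : ℝ, (∀ z : ℂ, ‖z‖ = 1 → ‖Q.eval z‖ ≤ M) →
      ‖coeffFunctional c Q‖ ≤ M)
    (hn : c n = 1) (hlt : ∀ k < n, c k = 0) {j : ℕ} (hj0 : 0 < j) (hjn : j ≤ n) :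
    c (n + j) = 0 := by
  set a : ℂ := -(starRingEnd ℂ) (c (n + j)) with ha
  have h := neg_le_re_of_norm_le hc (by rw [coeffFunctional_X_pow, hn])
    (Polynomial.C a * Polynomial.X ^ (n + j) -
      Polynomial.C ((starRingEnd ℂ) a) * Polynomial.X ^ (n - j)) 0 fun z hz => by
    have hzz : z * (starRingEnd ℂ) z = 1 := by
      rw [Complex.mul_conj, Complex.normSq_eq_norm_sq, hz]; simp
    have e : (Polynomial.C a * Polynomial.X ^ (n + j) -
        Polynomial.C ((starRingEnd ℂ) a) * Polynomial.X ^ (n - j)).eval z *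
        (starRingEnd ℂ) (z ^ n) = a * z ^ j - (starRingEnd ℂ) (a * z ^ j) := by
      simp only [Polynomial.eval_sub, Polynomial.eval_mul, Polynomial.eval_C, Polynomial.eval_pow,
        Polynomial.eval_X, map_mul, map_pow]
      have e1 : z ^ (n + j) * (starRingEnd ℂ) z ^ n = z ^ j := by
        rw [pow_add, mul_right_comm, ← mul_pow, hzz, one_pow, one_mul]
      have e2 : z ^ (n - j) * (starRingEnd ℂ) z ^ n = (starRingEnd ℂ) z ^ j := by
        conv_lhs => rw [← Nat.sub_add_cancel hjn, pow_add, Nat.add_sub_cancel, ← mul_assoc,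
          ← mul_pow, hzz, one_pow, one_mul]
      rw [sub_mul, mul_assoc, mul_assoc, e1, e2]
    rw [e, Complex.sub_re, Complex.conj_re, sub_self, neg_zero]
  rw [map_sub, coeffFunctional_C_mul_X_pow, coeffFunctional_C_mul_X_pow, hlt (n - j) (by omega),
    zero_mul, sub_zero, ha, mul_neg, Complex.mul_conj] at h
  simp only [Complex.neg_re, Complex.ofReal_re] at h
  exact Complex.normSq_eq_zero.mp (le_antisymm (by linarith) (Complex.normSq_nonneg _))

/-- The full series sums to `(1 + u) / (1 - u)`, whose real part is nonnegative; only the geometric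
tail can be negative. -/
theorem neg_le_re_geom_sum {u : ℂ} {r : ℝ} (hu : ‖u‖ = r) (hr : r < 1) (N : ℕ) :
    -(2 * r ^ N / (1 - r)) ≤ (2 * ∑ j ∈ Finset.range N, u ^ j - 1).re := by
  have hu1 : ‖u‖ < 1 := hu ▸ hr
  have hne : 1 - u ≠ 0 := fun h => by
    rw [← sub_eq_zero.mp h, norm_one] at hu1
    exact lt_irrefl _ hu1
  have hs : 2 * ∑ j ∈ Finset.range N, u ^ j - 1 = (1 + u) / (1 - u) - 2 * u ^ N / (1 - u) := by
    rw [geom_sum_eq (fun h => hne (by rw [h, sub_self]))]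
    have : u - 1 ≠ 0 := fun h => hne (by linear_combination -h)
    field_simp
    ring
  have h1 : 0 ≤ ((1 + u) / (1 - u)).re := by
    have e : (1 + u) / (1 - u) = (1 + u) * (starRingEnd ℂ) (1 - u) / (Complex.normSq (1 - u) : ℂ) := by
      rw [← Complex.mul_conj, mul_div_mul_right _ _ ((map_ne_zero _).mpr hne)]
    rw [e, Complex.div_ofReal_re]
    refine div_nonneg ?_ (Complex.normSq_nonneg _)
    have h2 : Complex.normSq u ≤ 1 := by
      rw [Complex.normSq_eq_norm_sq]
      exact pow_le_one₀ (norm_nonneg _) hu1.le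
    rw [Complex.normSq_apply] at h2
    simp
    nlinarith
  have h2 : (2 * u ^ N / (1 - u)).re ≤ 2 * r ^ N / (1 - r) := by
    refine (Complex.re_le_norm _).trans ?_
    rw [norm_div, norm_mul, norm_pow, hu]
    have h3 : 1 - r ≤ ‖1 - u‖ := by
      have := norm_sub_norm_le (1 : ℂ) u
      rwa [norm_one, hu] at this
    have h4 : 0 ≤ r := hu ▸ norm_nonneg u
    have h5 : 0 < 1 - r := by linarith
    rw [Complex.norm_ofNat]
    gcongr
  rw [hs, Complex.sub_re]
  linarith

/-- The functional is tested on `z ^ n` times a truncated series of `(1 + w z) / (1 - w z)`; its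
values tend to `2 F(w) / w ^ n - 1`. -/
theorem half_le_re_of_norm_le {F : ℂ → ℂ} {n : ℕ} (hF : DifferentiableOn ℂ F disc)
    (hc : ∀ Q : Polynomial ℂ, ∀ M : ℝ, (∀ z : ℂ, ‖z‖ = 1 → ‖Q.eval z‖ ≤ M) →
      ‖coeffFunctional (taylorCoeff F) Q‖ ≤ M)
    (hn : taylorCoeff F n = 1) (hlt : ∀ k < n, taylorCoeff F k = 0) {w : ℂ} (hw : w ∈ disc)
    (hw0 : w ≠ 0) : 1 / 2 ≤ (F w / w ^ n).re := by
  have hw1 : ‖w‖ < 1 := by simpa using hw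
  have hfin : ∀ N : ℕ, -(2 * ‖w‖ ^ N / (1 - ‖w‖)) ≤
      (2 * ∑ j ∈ Finset.range N, taylorCoeff F (n + j) * w ^ j - 1).re := fun N => by
    have h := neg_le_re_of_norm_le hc (by rw [coeffFunctional_X_pow, hn])
      (∑ j ∈ Finset.range N, Polynomial.C (2 * w ^ j) * Polynomial.X ^ (n + j) -
        Polynomial.X ^ n) (2 * ‖w‖ ^ N / (1 - ‖w‖)) fun z hz => by
      have hzz : z ^ n * (starRingEnd ℂ) (z ^ n) = 1 := by
        rw [Complex.mul_conj, Complex.normSq_eq_norm_sq, norm_pow, hz]; simp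
      have e : (∑ j ∈ Finset.range N, Polynomial.C (2 * w ^ j) * Polynomial.X ^ (n + j) -
          Polynomial.X ^ n).eval z * (starRingEnd ℂ) (z ^ n) =
          2 * ∑ j ∈ Finset.range N, (w * z) ^ j - 1 := by
        rw [Polynomial.eval_sub, Polynomial.eval_finsetSum, sub_mul, Polynomial.eval_pow,
          Polynomial.eval_X, hzz, Finset.sum_mul, Finset.mul_sum]
        congr 1
        refine Finset.sum_congr rfl fun j _ => ?_
        simp only [Polynomial.eval_mul, Polynomial.eval_C, Polynomial.eval_pow, Polynomial.eval_X]
        linear_combination 2 * w ^ j * z ^ j * hzz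
      rw [e]
      exact neg_le_re_geom_sum (by rw [norm_mul, hz, mul_one]) hw1 N
    convert h using 2
    rw [map_sub, map_sum, coeffFunctional_X_pow, hn, Finset.mul_sum]
    congr 1
    refine Finset.sum_congr rfl fun j _ => ?_
    rw [coeffFunctional_C_mul_X_pow]
    ring
  have hsum : HasSum (fun j => taylorCoeff F (n + j) * w ^ j) (F w / w ^ n) := by
    have h := (hasSum_nat_add_iff' n).mpr (hasSum_taylorCoeff hF hw)
    rw [Finset.sum_eq_zero fun k hk => by rw [hlt k (Finset.mem_range.mp hk), zero_mul],
      sub_zero] at h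
    refine (h.div_const (w ^ n)).congr_fun fun j => ?_
    rw [add_comm n j, pow_add]
    field_simp
  have hlim : Filter.Tendsto
      (fun N => (2 * ∑ j ∈ Finset.range N, taylorCoeff F (n + j) * w ^ j - 1).re) Filter.atTop
      (𝓝 (2 * (F w / w ^ n) - 1).re) :=
    (Complex.continuous_re.tendsto _).comp ((hsum.tendsto_sum_nat.const_mul 2).sub_const 1)
  have hlim0 : Filter.Tendsto (fun N : ℕ => -(2 * ‖w‖ ^ N / (1 - ‖w‖))) Filter.atTop (𝓝 0) := by
    simpa using (((tendsto_pow_atTop_nhds_zero_of_lt_one (norm_nonneg w) hw1).const_mul 2).div_const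
      (1 - ‖w‖)).neg
  have h := le_of_tendsto_of_tendsto' hlim0 hlim hfin
  simp only [Complex.sub_re, Complex.one_re, Complex.mul_re, Complex.re_ofNat, Complex.im_ofNat,
    zero_mul, sub_zero] at h
  linarith

/-! ### Reduction to `K + σ • L` and to best approximation -/

theorem exists_norm_one_norm_add_mul_eq (a b : ℂ) :
    ∃ σ : ℂ, ‖σ‖ = 1 ∧ ‖a + σ * b‖ = ‖a‖ + ‖b‖ := by
  obtain ⟨c, hc, hca⟩ := Complex.exists_norm_eq_mul_self a
  obtain ⟨d, hd, hdb⟩ := Complex.exists_norm_eq_mul_self b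
  have hc0 : c ≠ 0 := norm_ne_zero_iff.mp (by rw [hc]; exact one_ne_zero)
  refine ⟨c⁻¹ * d, by rw [norm_mul, norm_inv, hc, hd]; simp, ?_⟩
  have h : c * (a + c⁻¹ * d * b) = ((‖a‖ + ‖b‖ : ℝ) : ℂ) := by
    push_cast
    rw [hca, hdb]
    field_simp
  calc ‖a + c⁻¹ * d * b‖ = ‖c * (a + c⁻¹ * d * b)‖ := by rw [norm_mul, hc, one_mul]
    _ = ‖a‖ + ‖b‖ := by
      rw [h, Complex.norm_real, Real.norm_of_nonneg (by positivity)]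

theorem taylorCoeff_add_smul {K L : ℂ → ℂ} (hK : DifferentiableOn ℂ K disc)
    (hL : DifferentiableOn ℂ L disc) (σ : ℂ) (k : ℕ) :
    taylorCoeff (K + σ • L) k = taylorCoeff K k + σ * taylorCoeff L k := by
  rw [taylorCoeff_add (analyticAt_zero hK) ((analyticAt_zero hL).const_smul), taylorCoeff_smul]

theorem hadamard_add_smul {K L f : ℂ → ℂ} (hK : DifferentiableOn ℂ K disc)
    (hL : DifferentiableOn ℂ L disc) (hf : DifferentiableOn ℂ f disc) (σ : ℂ) {z : ℂ}
    (hz : z ∈ disc) :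
    hadamard (K + σ • L) f z = hadamard K f z + σ * hadamard L f z := by
  rw [hadamard_add_left hK (hL.const_smul σ) hf hz, hadamard_smul_left]

theorem hadamard_sub_polynomial {F f : ℂ → ℂ} {n : ℕ}
    (hf : DifferentiableOn ℂ f disc) (hlt : ∀ k < n, taylorCoeff F k = 0) {P : Polynomial ℂ}
    (hP : P.degree < (n : WithBot ℕ)) (z : ℂ) :
    hadamard F (fun z => f z - P.eval z) z = hadamard F f z := by
  refine tsum_congr fun k => ?_
  have h : taylorCoeff (fun z => f z - P.eval z) k = taylorCoeff f k - P.coeff k := by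
    rw [← taylorCoeff_polynomial]
    exact taylorCoeff_sub (analyticAt_zero hf) (analyticAt_polynomial P 0) k
  rw [h]
  rcases lt_or_ge k n with hk | hk
  · rw [hlt k hk]; ring
  · rw [Polynomial.coeff_eq_zero_of_degree_lt (hP.trans_le (by exact_mod_cast hk)), sub_zero]

theorem enorm_hadamard_add_le_bestApprox {K L : ℂ → ℂ} {n : ℕ} (hK : DifferentiableOn ℂ K disc)
    (hL : DifferentiableOn ℂ L disc)
    (hKc : ∀ k ≤ 2 * n, taylorCoeff K k = if k = n then 1 else 0)
    (hLc : ∀ k ≤ 2 * n, taylorCoeff L k = 0)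
    (hre : ∀ z ∈ disc, z ≠ 0 → ‖L z / z ^ n‖ ≤ (K z / z ^ n).re - 1 / 2)
    {f : ℂ → ℂ} (hf : MemHInf f) {z : ℂ} (hz : z ∈ disc) :
    ‖hadamard K f z‖ₑ + ‖hadamard L f z‖ₑ ≤ bestApprox n f := by
  refine le_iInf₂ fun P hP => ?_
  set g : ℂ → ℂ := fun z => f z - P.eval z with hg
  have hgd : DifferentiableOn ℂ g disc := hf.1.sub P.differentiable.differentiableOn
  -- The infinite case is trivial, so finiteness for `f - P` need not be proved.
  rcases eq_or_ne (supNorm g) ∞ with htop | htop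
  · rw [htop]; exact le_top
  have hgH : MemHInf g := ⟨hgd, htop.lt_top⟩
  rw [← hadamard_sub_polynomial hf.1
      (fun k hk => by rw [hKc k (by omega), if_neg hk.ne]) hP z,
    ← hadamard_sub_polynomial hf.1 (fun k hk => hLc k (by omega)) hP z]
  obtain ⟨σ, hσ, hsum⟩ := exists_norm_one_norm_add_mul_eq (hadamard K g z) (hadamard L g z)
  have h := norm_hadamard_le (F := K + σ • L) (f := g) (n := n) (M := (supNorm g).toReal)
    (hK.add (hL.const_smul σ))
    (fun k hk => by rw [taylorCoeff_add_smul hK hL, hKc k hk, hLc k hk, mul_zero, add_zero])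
    (fun w hw hw0 => by
      have e : (K + σ • L) w / w ^ n = K w / w ^ n + σ * (L w / w ^ n) := by
        simp only [Pi.add_apply, Pi.smul_apply, smul_eq_mul]
        ring
      have h1 := Complex.abs_re_le_norm (σ * (L w / w ^ n))
      rw [norm_mul, hσ, one_mul] at h1
      rw [e, Complex.add_re]
      linarith [hre w hw hw0, neg_le_of_abs_le h1])
    hgd (fun w hw => hgH.norm_le hw) hz
  rw [hadamard_add_smul hK hL hgd σ hz, hsum] at h
  rw [← ofReal_norm, ← ofReal_norm, ← ENNReal.ofReal_add (norm_nonneg _) (norm_nonneg _)]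
  exact ENNReal.ofReal_le_of_le_toReal h

theorem isBAP_hadamard_of_le_bestApprox {K : ℂ → ℂ} {n : ℕ} (hK : DifferentiableOn ℂ K disc)
    (hn : taylorCoeff K n = 1)
    (h : ∀ f, MemHInf f → supNorm (hadamard K f) ≤ bestApprox n f) : IsBAP n (hadamard K) where
  mapsTo f hf := ⟨differentiableOn_hadamard hK hf.1,
    ((h f hf).trans (bestApprox_le_supNorm n f)).trans_lt hf.2⟩
  map_add _ _ hf hg _ hz := hadamard_add_right hK hf.1 hg.1 hz
  map_smul c f _ z _ := hadamard_smul_right c K f z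
  bounded := ⟨1, fun f hf => by simpa using (h f hf).trans (bestApprox_le_supNorm n f)⟩
  map_monomial z _ := by
    rw [hadamard_pow, hn, one_mul]
  norm_le := h

/-- For `k < n` the monomial `z ^ k` is its own approximant, so its best approximation error is
zero. -/
theorem taylorCoeff_eq_zero_of_enorm_hadamard_le {F : ℂ → ℂ} {n : ℕ}
    (h : ∀ f, MemHInf f → ∀ z ∈ disc, ‖hadamard F f z‖ₑ ≤ bestApprox n f) {k : ℕ} (hk : k < n) :
    taylorCoeff F k = 0 := by
  have hhalf : (1 / 2 : ℂ) ∈ disc := by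
    rw [mem_ball_zero_iff]
    norm_num
  have hE : bestApprox n (fun z => (Polynomial.X ^ k : Polynomial ℂ).eval z) ≤ 0 := by
    refine (bestApprox_le_supNorm_sub n _ (Polynomial.X ^ k) ?_).trans ?_
    · rw [Polynomial.degree_X_pow]
      exact_mod_cast hk
    · simp [supNorm]
  have h1 := (h _ (memHInf_polynomial _) _ hhalf).trans hE
  simp only [Polynomial.eval_pow, Polynomial.eval_X] at h1
  rw [hadamard_pow] at h1
  simpa using h1

theorem norm_hadamard_polynomial_le {F : ℂ → ℂ} {n : ℕ}
    (h : ∀ f, MemHInf f → ∀ z ∈ disc, ‖hadamard F f z‖ₑ ≤ bestApprox n f)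
    (Q : Polynomial ℂ) (M : ℝ) (hQ : ∀ z : ℂ, ‖z‖ = 1 → ‖Q.eval z‖ ≤ M) (z : ℂ) (hz : z ∈ disc) :
    ‖hadamard F (fun z => Q.eval z) z‖ ≤ M := by
  have hM : 0 ≤ M := (norm_nonneg _).trans (hQ 1 norm_one)
  have h1 := ((h _ (memHInf_polynomial Q) z hz).trans (bestApprox_le_supNorm n _)).trans
    (supNorm_le_of_norm_le fun w hw => norm_polynomial_le_of_circle Q hQ hw)
  rw [← ofReal_norm] at h1
  exact (ENNReal.ofReal_le_ofReal_iff hM).mp h1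

end BAP

/-! ### The characterization -/

theorem theorem2 (n : ℕ) (K L : ℂ → ℂ)
    (hK : DifferentiableOn ℂ K BAP.disc) (hL : DifferentiableOn ℂ L BAP.disc)
    (hLn : L =O[𝓝 0] fun z : ℂ => z ^ n) :
    (BAP.IsBAP n (BAP.hadamard K) ∧
      ∀ f : ℂ → ℂ, BAP.MemHInf f →
        (⨆ z ∈ BAP.disc, (‖BAP.hadamard K f z‖ₑ + ‖BAP.hadamard L f z‖ₑ)) ≤ BAP.bestApprox n f) ↔
    ((fun z : ℂ => K z - z ^ n) =O[𝓝 0] (fun z : ℂ => z ^ (2 * n + 1)) ∧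
      L =O[𝓝 0] (fun z : ℂ => z ^ (2 * n + 1)) ∧
      ∀ z ∈ BAP.disc, z ≠ 0 → ‖L z / z ^ n‖ ≤ (K z / z ^ n).re - 1 / 2) := by
  have hpow : AnalyticAt ℂ (fun z : ℂ => z ^ n) 0 := by fun_prop
  have hKO : (fun z : ℂ => K z - z ^ n) =O[𝓝 0] (fun z : ℂ => z ^ (2 * n + 1)) ↔
      ∀ k ≤ 2 * n, BAP.taylorCoeff K k = if k = n then 1 else 0 := by
    refine (BAP.isBigO_pow_iff ((BAP.analyticAt_zero hK).sub hpow) (2 * n + 1)).trans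
      (forall_congr' fun k => ?_)
    rw [Nat.lt_succ_iff, BAP.taylorCoeff_sub (BAP.analyticAt_zero hK) hpow, BAP.taylorCoeff_pow,
      sub_eq_zero]
  have hLO : L =O[𝓝 0] (fun z : ℂ => z ^ (2 * n + 1)) ↔
      ∀ k ≤ 2 * n, BAP.taylorCoeff L k = 0 :=
    (BAP.isBigO_pow_iff (BAP.analyticAt_zero hL) (2 * n + 1)).trans
      (forall_congr' fun k => by rw [Nat.lt_succ_iff])
  rw [hKO, hLO]
  constructor
  · rintro ⟨hBAP, hle⟩
    have hKn : BAP.taylorCoeff K n = 1 := by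
      have h := hBAP.map_monomial (show (1 / 2 : ℂ) ∈ BAP.disc by
        rw [mem_ball_zero_iff]; norm_num)
      rw [BAP.hadamard_pow] at h
      exact mul_right_cancel₀ (pow_ne_zero n (by norm_num)) (h.trans (one_mul _).symm)
    -- The whole closed disc of `σ` is kept so that `σ = 0` isolates `K`.
    have hbound : ∀ σ : ℂ, ‖σ‖ ≤ 1 → ∀ f, BAP.MemHInf f → ∀ z ∈ BAP.disc,
        ‖BAP.hadamard (K + σ • L) f z‖ₑ ≤ BAP.bestApprox n f := fun σ hσ f hf z hz => by
      rw [BAP.hadamard_add_smul hK hL hf.1 σ hz]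
      refine (enorm_add_le _ _).trans ?_
      refine le_trans ?_ ((le_iSup₂ (f := fun z (_ : z ∈ BAP.disc) =>
        ‖BAP.hadamard K f z‖ₑ + ‖BAP.hadamard L f z‖ₑ) z hz).trans (hle f hf))
      gcongr
      rw [enorm_mul]
      exact mul_le_of_le_one_left' (by
        rw [← ofReal_norm]; exact ENNReal.ofReal_le_one.mpr hσ)
    have hfun := fun (σ : ℂ) (hσ : ‖σ‖ ≤ 1) =>
      BAP.norm_coeffFunctional_le (BAP.norm_hadamard_polynomial_le (hbound σ hσ))
    have hlt := fun (σ : ℂ) (hσ : ‖σ‖ ≤ 1) (k : ℕ) (hk : k < n) =>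
      BAP.taylorCoeff_eq_zero_of_enorm_hadamard_le (hbound σ hσ) hk
    have hLn0 : BAP.taylorCoeff L n = 0 := by
      -- With this phase the functional takes the value `1 + |L_n|` at `z ^ n`, yet is bounded by
      -- `1` there.
      obtain ⟨σ, hσ, hσL⟩ := Complex.exists_norm_eq_mul_self (BAP.taylorCoeff L n)
      have h := hfun σ hσ.le (Polynomial.X ^ n) 1 fun z hz => by simp [hz]
      rw [BAP.coeffFunctional_X_pow, BAP.taylorCoeff_add_smul hK hL, hKn, ← hσL] at h
      have h2 := (Complex.re_le_norm _).trans h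
      simp only [Complex.add_re, Complex.one_re, Complex.ofReal_re] at h2
      exact norm_le_zero_iff.mp (by linarith)
    have hFn : ∀ σ : ℂ, BAP.taylorCoeff (K + σ • L) n = 1 := fun σ => by
      rw [BAP.taylorCoeff_add_smul hK hL, hKn, hLn0, mul_zero, add_zero]
    have hF : ∀ σ : ℂ, ‖σ‖ ≤ 1 → ∀ k ≤ 2 * n,
        BAP.taylorCoeff K k + σ * BAP.taylorCoeff L k = if k = n then 1 else 0 := by
      intro σ hσ k hk
      rw [← BAP.taylorCoeff_add_smul hK hL]
      rcases lt_trichotomy k n with h | h | h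
      · rw [hlt σ hσ k h, if_neg h.ne]
      · rw [h, hFn, if_pos rfl]
      · obtain ⟨j, rfl⟩ := Nat.exists_eq_add_of_lt h
        rw [if_neg h.ne', add_assoc]
        exact BAP.coeff_eq_zero_of_norm_le (hfun σ hσ) (hFn σ) (hlt σ hσ) (by omega) (by omega)
    have hKc : ∀ k ≤ 2 * n, BAP.taylorCoeff K k = if k = n then 1 else 0 := fun k hk => by
      simpa using hF 0 (by simp) k hk
    refine ⟨hKc, fun k hk => ?_, fun z hz hz0 => ?_⟩
    · have h := hF 1 (by simp) k hk
      rwa [hKc k hk, one_mul, add_eq_left] at h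
    -- The phase `-σ` gives the worst case, turning the `L` term into `-|L z / z ^ n|`.
    · obtain ⟨σ, hσ, hσL⟩ := Complex.exists_norm_eq_mul_self (L z / z ^ n)
      have hσ' : ‖-σ‖ ≤ 1 := by rw [norm_neg, hσ]
      have h := BAP.half_le_re_of_norm_le (hK.add (hL.const_smul (-σ))) (hfun _ hσ') (hFn _)
        (hlt _ hσ') hz hz0
      have e : (K + (-σ) • L) z / z ^ n = K z / z ^ n - (‖L z / z ^ n‖ : ℂ) := by
        rw [hσL]
        simp only [Pi.add_apply, Pi.smul_apply, smul_eq_mul]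
        ring
      rw [e, Complex.sub_re, Complex.ofReal_re] at h
      linarith
  · rintro ⟨hKc, hLc, hre⟩
    have hmain := fun (f : ℂ → ℂ) (hf : BAP.MemHInf f) (z : ℂ) (hz : z ∈ BAP.disc) =>
      BAP.enorm_hadamard_add_le_bestApprox hK hL hKc hLc hre hf hz
    exact ⟨BAP.isBAP_hadamard_of_le_bestApprox hK (by rw [hKc n (by omega), if_pos rfl])
      fun f hf => iSup₂_le fun z hz => le_self_add.trans (hmain f hf z hz),
      fun f hf => iSup₂_le fun z hz => hmain f hf z hz⟩
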